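/- Let $O_{A_{\mathbb N}}$ be the universal $C^*$-algebra generated by a sequence of partial isometries $s_0,s_1,s_2,\dots$ subject to the relations $$s_i^*s_j=0\quad (i\neq j),\qquad s_i^*s_i=\sum_{k=0}^{i}s_ks_k^*\quad (i\ge 0).$$ Let $\mathcal F$ be the weakly monotone Fock space over $\ell^2(\mathbb N)$, $\mathbb N=\{1,2,\dots\}$, that is, the Hilbert space with orthonormal basis consisting of the vacuum vector $\Omega$ and of the vectors $e_{i_1}\otimes\cdots\otimes e_{i_k}$ with $k\ge 1$ and $i_1\ge i_2\ge\cdots\ge i_k\ge 1$. Let $P_\Omega$ be the orthogonal projection of $\mathcal F$ onto $\mathbb C\Omega$ and, for $i\ge 1$, let $A_i^\dagger$ be the bounded operator on $\mathcal F$ with $A_i^\dagger\Omega=e_i$, $A_i^\dagger(e_{i_1}\otimes\cdots\otimes e_{i_k})=e_i\otimes e_{i_1}\otimes\cdots\otimes e_{i_k}$ if $i\ge i_1$, and $A_i^\dagger(e_{i_1}\otimes\cdots\otimes e_{i_k})=0$ otherwise. For $z\in\mathbb T=\{z\in\mathbb C:|z|=1\}$ let $\widetilde\pi_{0,z}:O_{A_{\mathbb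 N}}\to\mathcal B(\mathcal F)$ be the representation determined by $\widetilde\pi_{0,z}(s_0)=zP_\Omega$ and $\widetilde\pi_{0,z}(s_i)=A_i^\dagger$ for $i\ge 1$. Then the direct sum $$\pi:=\bigoplus_{z\in\mathbb T}\widetilde\pi_{0,z}:O_{A_{\mathbb N}}\to\mathcal B\Big(\bigoplus_{z\in\mathbb T}\mathcal F\Big)$$ is a faithful (i.e. injective) representation of $O_{A_{\mathbb N}}$. -/

import Mathlib

open scoped ENNReal

noncomputable section

namespace WeaklyMonotone

/-! ### The universal algebra -/

/-- A sequence of partial isometries `s₀, s₁, …` in a C⋆-algebra with `sᵢ⋆ sⱼ = 0` for `i ≠ j` and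
`sᵢ⋆ sᵢ = ∑_{k ≤ i} sₖ sₖ⋆`. -/
structure IsFamily {B : Type*} [NonUnitalCStarAlgebra B] (s : ℕ → B) : Prop where
  partialIsometry : ∀ i, s i * star (s i) * s i = s i
  orthogonal : ∀ i j, i ≠ j → star (s i) * s j = 0
  source_eq : ∀ i, star (s i) * s i = ∑ k ∈ Finset.range (i + 1), s k * star (s k)

theorem IsFamily.norm_le_one {B : Type*} [NonUnitalCStarAlgebra B] {s : ℕ → B} (h : IsFamily s)
    (i : ℕ) : ‖s i‖ ≤ 1 := by
  have h1 : ‖star (s i) * s i‖ = ‖s i‖ * ‖s i‖ := CStarRing.norm_star_mul_self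
  have h2 : ‖star (star (s i) * s i) * (star (s i) * s i)‖
      = ‖star (s i) * s i‖ * ‖star (s i) * s i‖ := CStarRing.norm_star_mul_self
  have h3 : star (star (s i) * s i) * (star (s i) * s i) = star (s i) * s i := by
    rw [star_mul, star_star, mul_assoc, ← mul_assoc (s i), h.partialIsometry i]
  rw [h3, h1] at h2
  have h4 := norm_nonneg (s i)
  by_contra hc
  push Not at hc
  have h5 : 1 < ‖s i‖ * ‖s i‖ := by nlinarith
  nlinarith

/-- A realization of the generators and relations in some C⋆-algebra. -/
structure Realization where
  carrier : Type
  [inst : NonUnitalCStarAlgebra carrier]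
  family : ℕ → carrier
  isFamily : IsFamily family

instance (r : Realization) : NonUnitalCStarAlgebra r.carrier := r.inst

/-- The C⋆-algebra of bounded elements of the product of all realizations. -/
abbrev Ambient : Type 1 := lp (fun r : Realization => r.carrier) ∞

/-- The `i`-th generators of all realizations, put together. -/
def ambientGen (i : ℕ) : Ambient :=
  ⟨fun r => r.family i, memℓp_infty ⟨1, by
    rintro _ ⟨r, rfl⟩
    exact r.isFamily.norm_le_one i⟩⟩

/-- The closed ⋆-subalgebra generated by the joint generators. The norm of a ⋆-polynomial in the
generators is thus the supremum of its norms in all realizations. -/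
def universalSubalgebra : NonUnitalStarSubalgebra ℂ Ambient :=
  (NonUnitalStarAlgebra.adjoin ℂ (Set.range ambientGen)).topologicalClosure

instance : IsClosed (universalSubalgebra : Set Ambient) :=
  NonUnitalStarSubalgebra.isClosed_topologicalClosure _

/-- The universal C⋆-algebra generated by partial isometries `s₀, s₁, …` with `sᵢ⋆ sⱼ = 0` for
`i ≠ j` and `sᵢ⋆ sᵢ = ∑_{k ≤ i} sₖ sₖ⋆`; see `UniversalAlgebra.existsUnique_lift` for its universal
property. -/
abbrev UniversalAlgebra : Type 1 := universalSubalgebra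

instance : NonUnitalCStarAlgebra UniversalAlgebra :=
  NonUnitalStarSubalgebra.nonUnitalCStarAlgebra universalSubalgebra

namespace UniversalAlgebra

/-- The generators of the universal algebra. -/
def gen (i : ℕ) : UniversalAlgebra :=
  ⟨ambientGen i, NonUnitalStarSubalgebra.le_topologicalClosure _
    (NonUnitalStarAlgebra.subset_adjoin ℂ _ ⟨i, rfl⟩)⟩

/-- The projection onto a realization. -/
def eval (r : Realization) : UniversalAlgebra →⋆ₙₐ[ℂ] r.carrier where
  toFun x := (x : Ambient) r
  map_smul' _ _ := rfl
  map_zero' := rfl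
  map_add' _ _ := rfl
  map_mul' _ _ := rfl
  map_star' _ := rfl

@[simp]
theorem eval_gen (r : Realization) (i : ℕ) : eval r (gen i) = r.family i := rfl

/-- The ⋆-homomorphism defined by the images of the generators. -/
def lift {B : Type} [NonUnitalCStarAlgebra B] (t : ℕ → B) (ht : IsFamily t) :
    UniversalAlgebra →⋆ₙₐ[ℂ] B :=
  eval ⟨B, t, ht⟩

@[simp]
theorem lift_gen {B : Type} [NonUnitalCStarAlgebra B] (t : ℕ → B) (ht : IsFamily t) (i : ℕ) :
    lift t ht (gen i) = t i := rfl

theorem ext_eval {x y : UniversalAlgebra} (h : ∀ r, eval r x = eval r y) : x = y :=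
  Subtype.ext (lp.ext (funext h))

theorem isFamily_gen : IsFamily gen where
  partialIsometry i := ext_eval fun r => by
    simpa only [map_mul, map_star, eval_gen] using r.isFamily.partialIsometry i
  orthogonal i j hij := ext_eval fun r => by
    simpa only [map_mul, map_star, map_zero, eval_gen] using r.isFamily.orthogonal i j hij
  source_eq i := ext_eval fun r => by
    simpa only [map_mul, map_star, map_sum, eval_gen] using r.isFamily.source_eq i

theorem hom_ext {B : Type*} [NonUnitalCStarAlgebra B] {φ ψ : UniversalAlgebra →⋆ₙₐ[ℂ] B}
    (h : ∀ i, φ (gen i) = ψ (gen i)) : φ = ψ := by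
  have key : ∀ (x : Ambient) (hx : x ∈ NonUnitalStarAlgebra.adjoin ℂ (Set.range ambientGen)),
      φ ⟨x, NonUnitalStarSubalgebra.le_topologicalClosure _ hx⟩
        = ψ ⟨x, NonUnitalStarSubalgebra.le_topologicalClosure _ hx⟩ := by
    intro x hx
    induction hx using NonUnitalStarAlgebra.adjoin_induction with
    | mem x hx => obtain ⟨i, rfl⟩ := hx; exact h i
    | add x y hx hy h1 h2 =>
      have := congrArg₂ (· + ·) h1 h2
      simp only [← map_add] at this; exact this
    | zero => exact (map_zero φ).trans (map_zero ψ).symm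
    | mul x y hx hy h1 h2 =>
      have := congrArg₂ (· * ·) h1 h2
      simp only [← map_mul] at this; exact this
    | smul c x hx h1 =>
      have := congrArg (c • ·) h1
      simp only [← map_smul] at this; exact this
    | star x hx h1 =>
      have := congrArg star h1
      simp only [← map_star] at this; exact this
  ext ⟨x, hx⟩
  obtain ⟨u, hu, hux⟩ := mem_closure_iff_seq_limit.1
    (show x ∈ closure (NonUnitalStarAlgebra.adjoin ℂ (Set.range ambientGen) : Set Ambient) from hx)
  have hlim : Filter.Tendsto (fun n => (⟨u n,
      NonUnitalStarSubalgebra.le_topologicalClosure _ (hu n)⟩ : UniversalAlgebra))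
      Filter.atTop (nhds ⟨x, hx⟩) := tendsto_subtype_rng.2 hux
  have cont : ∀ χ : UniversalAlgebra →⋆ₙₐ[ℂ] B, Continuous χ := fun χ =>
    AddMonoidHomClass.continuous_of_bound χ 1 fun a => by
      simpa using NonUnitalStarAlgHom.norm_apply_le χ a
  have h1 := ((cont φ).tendsto _).comp hlim
  have h2 := ((cont ψ).tendsto _).comp hlim
  refine tendsto_nhds_unique h1 (h2.congr fun n => ?_)
  exact (key (u n) (hu n)).symm

end UniversalAlgebra

/-- Formal ⋆-polynomials; they only serve to bound the size of a C⋆-algebra with countably many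
generators. -/
inductive Term : Type
  | gen : ℕ → Term
  | zero : Term
  | add : Term → Term → Term
  | mul : Term → Term → Term
  | smul : ℂ → Term → Term
  | star : Term → Term

/-- The value of a formal ⋆-polynomial. -/
def Term.eval {B : Type*} [NonUnitalCStarAlgebra B] (t : ℕ → B) : Term → B
  | .gen i => t i
  | .zero => 0
  | .add a b => a.eval t + b.eval t
  | .mul a b => a.eval t * b.eval t
  | .smul c a => c • a.eval t
  | .star a => Star.star (a.eval t)

open Filter Topology in
theorem small_closure {B : Type*} [NonUnitalCStarAlgebra B] (t : ℕ → B) :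
    Small.{0} (NonUnitalStarAlgebra.adjoin ℂ (Set.range t)).topologicalClosure := by
  have h1 : ∀ x ∈ NonUnitalStarAlgebra.adjoin ℂ (Set.range t), ∃ a : Term, a.eval t = x := by
    intro x hx
    induction hx using NonUnitalStarAlgebra.adjoin_induction with
    | mem x hx => obtain ⟨i, rfl⟩ := hx; exact ⟨.gen i, rfl⟩
    | add x y hx hy h1 h2 =>
      obtain ⟨a, rfl⟩ := h1; obtain ⟨b, rfl⟩ := h2; exact ⟨.add a b, rfl⟩
    | zero => exact ⟨.zero, rfl⟩
    | mul x y hx hy h1 h2 =>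
      obtain ⟨a, rfl⟩ := h1; obtain ⟨b, rfl⟩ := h2; exact ⟨.mul a b, rfl⟩
    | smul c x hx h1 => obtain ⟨a, rfl⟩ := h1; exact ⟨.smul c a, rfl⟩
    | star x hx h1 => obtain ⟨a, rfl⟩ := h1; exact ⟨.star a, rfl⟩
  have h2 : ((NonUnitalStarAlgebra.adjoin ℂ (Set.range t)).topologicalClosure : Set B) ⊆
      Set.range fun f : ℕ → Term => limUnder Filter.atTop fun n => (f n).eval t := by
    intro x hx
    obtain ⟨u, hu, hux⟩ := mem_closure_iff_seq_limit.1
      (show x ∈ closure (NonUnitalStarAlgebra.adjoin ℂ (Set.range t) : Set B) from hx)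
    choose f hf using fun n => h1 (u n) (hu n)
    exact ⟨f, by simp only [hf]; exact hux.limUnder_eq⟩
  exact small_subset h2

/-- A C⋆-algebra with a small underlying type has an isomorphic copy in the lowest universe. -/
theorem exists_copy (B : Type*) [NonUnitalCStarAlgebra B] [Small.{0} B] :
    ∃ (C : Type) (_ : NonUnitalCStarAlgebra C), Nonempty (C ≃⋆ₐ[ℂ] B) := by
  let e : Shrink.{0} B ≃ B := (equivShrink B).symm
  let _ : NonUnitalRing (Shrink.{0} B) := e.nonUnitalRing
  let _ : Module ℂ (Shrink.{0} B) := e.module ℂ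
  let f : Shrink.{0} B →ₙₐ[ℂ] B :=
    { toFun := e
      map_smul' := fun c x => e.apply_symm_apply _
      map_zero' := e.apply_symm_apply _
      map_add' := fun x y => e.apply_symm_apply _
      map_mul' := fun x y => e.apply_symm_apply _ }
  have hf : Function.Injective f := e.injective
  let _ : NonUnitalNormedRing (Shrink.{0} B) := NonUnitalNormedRing.induced _ _ f hf
  have hn : ∀ x, ‖x‖ = ‖f x‖ := fun x => rfl
  let _ : NormedSpace ℂ (Shrink.{0} B) := NormedSpace.induced ℂ _ _ f
  have hstar : ∀ x, f (e.symm (star (f x))) = star (f x) := fun x => e.apply_symm_apply _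
  let _ : StarRing (Shrink.{0} B) :=
    { star := fun x => e.symm (star (f x))
      star_involutive := fun x => hf (by rw [hstar, hstar, star_star])
      star_mul := fun x y => hf (by rw [hstar, map_mul, map_mul, hstar, hstar, star_mul])
      star_add := fun x y => hf (by rw [hstar, map_add, map_add, hstar, hstar, star_add]) }
  have hst : ∀ x, f (star x) = star (f x) := hstar
  have hiso : Isometry f := AddMonoidHomClass.isometry_of_norm f fun x => rfl
  have hc : CompleteSpace (Shrink.{0} B) :=
    (hiso.isUniformInducing.completeSpace_congr e.surjective).2 inferInstance
  refine ⟨Shrink.{0} B,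
    { norm_mul_self_le := fun x => by
        rw [hn, hn, map_mul, hst, CStarRing.norm_star_mul_self]
      smul_assoc := fun c x y => hf (by simp [smul_mul_assoc])
      smul_comm := fun c x y => hf (by simp [mul_smul_comm])
      star_smul := fun c x => hf (by simp [hst])
      norm_smul_le := norm_smul_le }, ⟨?_⟩⟩
  exact
    { e with
      map_mul' := map_mul f
      map_add' := map_add f
      map_star' := hst
      map_smul' := map_smul f }

/-- The universal property, with respect to C⋆-algebras in any universe. -/
theorem UniversalAlgebra.existsUnique_lift {B : Type*} [NonUnitalCStarAlgebra B] (t : ℕ → B)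
    (ht : IsFamily t) : ∃! φ : UniversalAlgebra →⋆ₙₐ[ℂ] B, ∀ i, φ (gen i) = t i := by
  let S := (NonUnitalStarAlgebra.adjoin ℂ (Set.range t)).topologicalClosure
  have _ : IsClosed (S : Set B) := NonUnitalStarSubalgebra.isClosed_topologicalClosure _
  have _ : Small.{0} S := small_closure t
  obtain ⟨C, _, ⟨e⟩⟩ := exists_copy S
  let t' : ℕ → S := fun i => ⟨t i, NonUnitalStarSubalgebra.le_topologicalClosure _
    (NonUnitalStarAlgebra.subset_adjoin ℂ _ ⟨i, rfl⟩)⟩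
  have ht' : IsFamily t' :=
    ⟨fun i => Subtype.ext (ht.partialIsometry i), fun i j h => Subtype.ext (ht.orthogonal i j h),
      fun i => Subtype.ext (by simpa [t'] using ht.source_eq i)⟩
  have hC : IsFamily fun i => e.symm (t' i) :=
    ⟨fun i => by simpa only [map_mul, map_star] using congrArg e.symm (ht'.partialIsometry i),
      fun i j h => by
        simpa only [map_mul, map_star, map_zero] using congrArg e.symm (ht'.orthogonal i j h),
      fun i => by
        simpa only [map_mul, map_star, map_sum] using congrArg e.symm (ht'.source_eq i)⟩
  refine ⟨(NonUnitalStarSubalgebraClass.subtype S).comp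
    ((e : C →⋆ₙₐ[ℂ] S).comp (lift _ hC)), fun i => ?_, fun ψ hψ => hom_ext fun i => ?_⟩
  · simp [t']
  · rw [hψ]; simp [t']

/-! ### Direct sums of representations -/

section DirectSum

variable {ι : Type*} {H : ι → Type*} [∀ i, NormedAddCommGroup (H i)]
  [∀ i, InnerProductSpace ℂ (H i)]

/-- The operator `⊕ᵢ Tᵢ` on the Hilbert space direct sum `⊕ᵢ Hᵢ`, for a uniformly bounded family of
operators. -/
def directSumOp (T : ∀ i, H i →L[ℂ] H i) (C : ℝ) (hT : ∀ i, ‖T i‖ ≤ C) :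
    lp H 2 →L[ℂ] lp H 2 :=
  have hle : ∀ (ξ : lp H 2) (i : ι), ‖T i (ξ i)‖ ≤ ‖(((|C| : ℝ) : ℂ) • ξ : lp H 2) i‖ := fun ξ i => by
    rw [lp.coeFn_smul, Pi.smul_apply, norm_smul, Complex.norm_real, norm_abs_eq_norm]
    exact (T i).le_of_opNorm_le ((hT i).trans (le_abs_self C)) (ξ i)
  LinearMap.mkContinuous
    { toFun := fun ξ => ⟨fun i => T i (ξ i),
        (lp.memℓp (((|C| : ℝ) : ℂ) • ξ : lp H 2)).mono' (hle ξ)⟩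
      map_add' := fun ξ η => lp.ext (funext fun i => (T i).map_add _ _)
      map_smul' := fun c ξ => lp.ext (funext fun i => (T i).map_smul _ _) } |C| fun ξ => by
    refine (lp.norm_mono two_ne_zero (hle ξ)).trans_eq ?_
    rw [norm_smul, Complex.norm_real, norm_abs_eq_norm, Real.norm_eq_abs]

@[simp]
theorem directSumOp_apply (T : ∀ i, H i →L[ℂ] H i) (C : ℝ) (hT : ∀ i, ‖T i‖ ≤ C) (ξ : lp H 2)
    (i : ι) : directSumOp T C hT ξ i = T i (ξ i) := rfl

variable [∀ i, CompleteSpace (H i)]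

/-- The direct sum `⊕ᵢ πᵢ` of a family of representations of a C⋆-algebra. -/
def directSumRep {A : Type*} [NonUnitalCStarAlgebra A] (π : ∀ i, A →⋆ₙₐ[ℂ] (H i →L[ℂ] H i)) :
    A →⋆ₙₐ[ℂ] (lp H 2 →L[ℂ] lp H 2) where
  toFun a := directSumOp (fun i => π i a) ‖a‖ fun i => NonUnitalStarAlgHom.norm_apply_le (π i) a
  map_smul' c a := by ext ξ i; simp
  map_zero' := by ext ξ i; simp
  map_add' a b := by ext ξ i; simp
  map_mul' a b := by ext ξ i; simp
  map_star' a := by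
    rw [ContinuousLinearMap.star_eq_adjoint, ContinuousLinearMap.eq_adjoint_iff]
    intro ξ η
    rw [lp.inner_eq_tsum, lp.inner_eq_tsum]
    refine tsum_congr fun i => ?_
    simp [map_star, ContinuousLinearMap.star_eq_adjoint, ContinuousLinearMap.adjoint_inner_left]

@[simp]
theorem directSumRep_apply {A : Type*} [NonUnitalCStarAlgebra A]
    (π : ∀ i, A →⋆ₙₐ[ℂ] (H i →L[ℂ] H i)) (a : A) (ξ : lp H 2) (i : ι) :
    directSumRep π a ξ i = π i a (ξ i) := rfl

end DirectSum

/-! ### The weakly monotone Fock space -/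

section PartialBijection

variable {α : Type*}

/-- The partial isometry of `ℓ²(α)` induced by a partial bijection `f` of `α`: it maps the basis
vector `e_a` to `e_{f a}` if `f a` is defined, and to `0` otherwise. -/
def partialOp (f : α ≃. α) : lp (fun _ : α => ℂ) 2 →L[ℂ] lp (fun _ : α => ℂ) 2 :=
  have h2 : (0 : ℝ) < (2 : ℝ≥0∞).toReal := by norm_num
  have hle : ∀ (ξ : lp (fun _ : α => ℂ) 2) (s : Finset α),
      ∑ b ∈ s, ‖(f.symm b).elim 0 ξ‖ ^ (2 : ℝ≥0∞).toReal ≤ ‖ξ‖ ^ (2 : ℝ≥0∞).toReal := by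
    intro ξ s
    classical
    refine le_trans ?_ (lp.sum_rpow_le_norm_rpow h2 ξ
      (s.filterMap f.symm fun a b c ha hb => f.symm.inj ha hb))
    rw [← Finset.sum_filter_of_ne (p := fun b => (f.symm b).isSome)]
    · refine le_of_eq (Finset.sum_bij (fun b hb => (f.symm b).get (Finset.mem_filter.1 hb).2)
        ?_ ?_ ?_ ?_)
      · intro b hb
        exact Finset.mem_filterMap _ |>.2 ⟨b, (Finset.mem_filter.1 hb).1, by simp⟩
      · intro b hb c hc h
        refine f.symm.inj (Option.get_mem (Finset.mem_filter.1 hb).2) ?_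
        rw [h]
        exact Option.get_mem _
      · intro a ha
        obtain ⟨b, hb, h⟩ := Finset.mem_filterMap _ |>.1 ha
        exact ⟨b, Finset.mem_filter.2 ⟨hb, by simp [h]⟩, by simp [h]⟩
      · intro b hb
        obtain ⟨a, ha⟩ := Option.isSome_iff_exists.1 (Finset.mem_filter.1 hb).2
        simp [ha]
    · intro b _ hb
      by_contra h
      simp_all
  LinearMap.mkContinuous
    { toFun := fun ξ => ⟨fun b => (f.symm b).elim 0 ξ, memℓp_gen' (hle ξ)⟩
      map_add' := fun ξ η => lp.ext (funext fun b => by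
        change (f.symm b).elim 0 ⇑(ξ + η) = (f.symm b).elim 0 ξ + (f.symm b).elim 0 η
        rcases f.symm b with _ | a
        · simp only [Option.elim_none, add_zero]
        · rfl)
      map_smul' := fun c ξ => lp.ext (funext fun b => by
        change (f.symm b).elim 0 ⇑(c • ξ) = c • (f.symm b).elim 0 ξ
        rcases f.symm b with _ | a
        · simp only [Option.elim_none, smul_zero]
        · rfl) } 1 fun ξ => by
    rw [one_mul]
    exact lp.norm_le_of_forall_sum_le h2 (norm_nonneg ξ) (hle ξ)

theorem partialOp_apply (f : α ≃. α) (ξ : lp (fun _ : α => ℂ) 2) (b : α) :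
    partialOp f ξ b = (f.symm b).elim 0 ξ := rfl

theorem partialOp_single [DecidableEq α] (f : α ≃. α) (a : α) (c : ℂ) :
    partialOp f (lp.single 2 a c) = (f a).elim 0 fun b => lp.single 2 b c := by
  ext b
  rw [partialOp_apply]
  rcases h : f a with _ | b'
  · rcases h' : f.symm b with _ | a'
    · simp
    · have := (f.eq_some_iff).1 h'
      have hne : a' ≠ a := by rintro rfl; simp_all
      simp [hne]
  · have hb := (f.eq_some_iff).2 h
    by_cases hbb : b = b'
    · subst hbb; simp [hb]
    · rcases h' : f.symm b with _ | a'
      · simp [hbb]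
      · have := (f.eq_some_iff).1 h'
        have hne : a' ≠ a := by rintro rfl; simp_all
        simp [hne, hbb]

theorem star_partialOp (f : α ≃. α) : star (partialOp f) = partialOp f.symm := by
  classical
  rw [ContinuousLinearMap.star_eq_adjoint]
  ext ξ a
  have h := lp.inner_single_left (𝕜 := ℂ) (G := fun _ : α => ℂ) a 1
    (ContinuousLinearMap.adjoint (partialOp f) ξ)
  rw [ContinuousLinearMap.adjoint_inner_right, partialOp_single] at h
  rw [partialOp_apply, PEquiv.symm_symm]
  rcases hfa : f a with _ | b
  · rw [hfa] at h; simpa using h.symm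
  · rw [hfa] at h
    simp only [Option.elim_some, lp.inner_single_left] at h
    simpa using h.symm

end PartialBijection

/-- Weakly decreasing finite words `i₁ ≥ i₂ ≥ … ≥ iₖ ≥ 1`, including the empty word. -/
abbrev Word : Type := {l : List ℕ+ // l.IsChain (· ≥ ·)}

/-- The weakly monotone Fock space over `ℓ²(ℕ)`, `ℕ = {1, 2, …}`: the Hilbert space whose canonical
orthonormal basis consists of the vectors `e_{i₁} ⊗ ⋯ ⊗ e_{iₖ}` with `i₁ ≥ ⋯ ≥ iₖ ≥ 1`, indexed here
by the words `i₁ ⋯ iₖ`. -/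
abbrev Fock : Type := lp (fun _ : Word => ℂ) 2

/-- The basis vector `e_{i₁} ⊗ ⋯ ⊗ e_{iₖ}`. -/
def basisVec (w : Word) : Fock := lp.single 2 w 1

/-- The vacuum vector. -/
def vacuum : Fock := basisVec ⟨[], List.isChain_nil⟩

/-- The orthogonal projection onto the vacuum vector. -/
def vacuumProj : Fock →L[ℂ] Fock := (ℂ ∙ vacuum).starProjection

/-- The partial bijection `w ↦ i w`, defined if `i w` is weakly decreasing. -/
def prepend (i : ℕ+) : Word ≃. Word where
  toFun w := if h : (i :: w.1).IsChain (· ≥ ·) then some ⟨i :: w.1, h⟩ else none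
  invFun
    | ⟨[], _⟩ => none
    | ⟨j :: l, h⟩ => if j = i then some ⟨l, h.tail⟩ else none
  inv := by
    rintro ⟨a, ha⟩ ⟨_ | ⟨j, l⟩, h⟩
    · simp
    · by_cases hj : j = i
      · subst hj
        constructor
        · intro e
          obtain rfl : l = a := congrArg Subtype.val (Option.some.inj ((if_pos rfl).symm.trans e))
          exact dif_pos h
        · intro e
          by_cases hc : (j :: a).IsChain (· ≥ ·)
          · rw [dif_pos hc] at e
            have e' : j :: a = j :: l := congrArg Subtype.val (Option.some.inj e)
            obtain rfl : a = l := (List.cons.inj e').2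
            exact if_pos rfl
          · rw [dif_neg hc] at e
            exact absurd e (by simp)
      · simp [hj, Ne.symm hj]

/-- The weakly monotone creator `Aᵢ†`. -/
def creator (i : ℕ+) : Fock →L[ℂ] Fock := partialOp (prepend i)

theorem creator_vacuum (i : ℕ+) :
    creator i vacuum = basisVec ⟨[i], List.isChain_singleton i⟩ := by
  simp [creator, vacuum, basisVec, partialOp_single, prepend]

theorem creator_basisVec_of_le (i j : ℕ+) (l : List ℕ+) (h : (j :: l).IsChain (· ≥ ·))
    (hij : j ≤ i) :
    creator i (basisVec ⟨j :: l, h⟩)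
      = basisVec ⟨i :: j :: l, List.isChain_cons_cons.2 ⟨hij, h⟩⟩ := by
  have : (i :: j :: l).IsChain (· ≥ ·) := List.isChain_cons_cons.2 ⟨hij, h⟩
  simp [creator, basisVec, partialOp_single, prepend, -List.isChain_cons_cons, this]

theorem creator_basisVec_of_lt (i j : ℕ+) (l : List ℕ+) (h : (j :: l).IsChain (· ≥ ·))
    (hij : i < j) : creator i (basisVec ⟨j :: l, h⟩) = 0 := by
  have : ¬ (i :: j :: l).IsChain (· ≥ ·) := fun hc =>
    absurd (List.isChain_cons_cons.1 hc).1 (not_le.2 hij)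
  simp [creator, basisVec, partialOp_single, prepend, -List.isChain_cons_cons, this]

theorem creator_apply_nil (i : ℕ+) (ξ : Fock) (h : [].IsChain (· ≥ ·)) :
    creator i ξ ⟨[], h⟩ = 0 := rfl

theorem creator_apply_cons (i j : ℕ+) (l : List ℕ+) (h : (j :: l).IsChain (· ≥ ·)) (ξ : Fock) :
    creator i ξ ⟨j :: l, h⟩ = if j = i then ξ ⟨l, h.tail⟩ else 0 := by
  rw [creator, partialOp_apply]
  change (if j = i then some (⟨l, h.tail⟩ : Word) else none).elim 0 ξ = _
  split_ifs <;> rfl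

theorem star_creator_apply (i : ℕ+) (w : Word) (ξ : Fock) :
    (star (creator i)) ξ w = if h : (i :: w.1).IsChain (· ≥ ·) then ξ ⟨i :: w.1, h⟩ else 0 := by
  rw [creator, star_partialOp, partialOp_apply]
  change (if h : (i :: w.1).IsChain (· ≥ ·) then some (⟨i :: w.1, h⟩ : Word) else none).elim 0 ξ = _
  split_ifs <;> rfl

theorem vacuumProj_apply (ξ : Fock) : vacuumProj ξ = ξ ⟨[], List.isChain_nil⟩ • vacuum := by
  have hn : ‖vacuum‖ = 1 := by
    rw [vacuum, basisVec, lp.norm_single (by norm_num)]; simp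
  rw [vacuumProj, Submodule.starProjection_unit_singleton ℂ hn, vacuum, basisVec,
    lp.inner_single_left]
  simp

/-- The images of the generators under the representation with phase `z`: `s₀ ↦ z P_Ω` and
`sᵢ ↦ Aᵢ†` for `i ≥ 1`. -/
def fockFamily (z : Circle) : ℕ → (Fock →L[ℂ] Fock)
  | 0 => (z : ℂ) • vacuumProj
  | n + 1 => creator n.succPNat

theorem isFamily_fockFamily (z : Circle) : IsFamily (fockFamily z) := by
  have hz : (starRingEnd ℂ) z * z = 1 := by
    rw [← Complex.normSq_eq_conj_mul_self, Circle.normSq_coe, Complex.ofReal_one]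
  have hz' : (z : ℂ) * (starRingEnd ℂ) z = 1 := by rw [mul_comm, hz]
  have hP : star vacuumProj = vacuumProj := isSelfAdjoint_starProjection _
  have hPP : vacuumProj * vacuumProj = vacuumProj :=
    Submodule.isIdempotentElem_starProjection _
  have hV : ∀ (j : ℕ+) (l : List ℕ+) (h : (j :: l).IsChain (· ≥ ·)), vacuum ⟨j :: l, h⟩ = 0 :=
    fun j l h => lp.single_apply_ne _ _ _ (by simp)
  have hV0 : ∀ h : [].IsChain (· ≥ ·), vacuum ⟨[], h⟩ = 1 := fun h => lp.single_apply_self _ _ _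
  have h00 : star (fockFamily z 0) * fockFamily z 0 = vacuumProj := by
    simp [fockFamily, star_smul, hP, hPP, smul_smul, hz']
  have h00' : fockFamily z 0 * star (fockFamily z 0) = vacuumProj := by
    simp [fockFamily, star_smul, hP, hPP, smul_smul, hz]
  have hsrc : ∀ (i : ℕ+) (ξ : Fock) (w : Word), (star (creator i) * creator i) ξ w
      = if (i :: w.1).IsChain (· ≥ ·) then ξ w else 0 := by
    intro i ξ w
    rw [mul_apply_eq_comp, star_creator_apply]
    split_ifs with h
    · rw [creator_apply_cons, if_pos rfl]
    · rfl
  have hrng : ∀ (i j : ℕ+) (l : List ℕ+) (h : (j :: l).IsChain (· ≥ ·)) (ξ : Fock),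
      (creator i * star (creator i)) ξ ⟨j :: l, h⟩ = if j = i then ξ ⟨j :: l, h⟩ else 0 := by
    intro i j l h ξ
    rw [mul_apply_eq_comp, creator_apply_cons]
    split_ifs with hji
    · subst hji
      rw [star_creator_apply, dif_pos h]
    · rfl
  have hPc : ∀ i : ℕ+, vacuumProj * creator i = 0 := by
    intro i
    ext ξ : 1
    rw [mul_apply_eq_comp, vacuumProj_apply, creator_apply_nil, zero_smul]
    rfl
  refine ⟨?_, ?_, ?_⟩
  · rintro (_ | n)
    · rw [h00']
      simp [fockFamily, hPP]
    · ext ξ w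
      rw [mul_assoc]
      change creator n.succPNat ((star (creator n.succPNat) * creator n.succPNat) ξ) w
        = creator n.succPNat ξ w
      obtain ⟨_ | ⟨j, l⟩, h⟩ := w
      · rfl
      · rw [creator_apply_cons, creator_apply_cons]
        split_ifs with hj
        · subst hj
          rw [hsrc, if_pos h]
        · rfl
  · rintro (_ | m) (_ | n) hmn
    · exact absurd rfl hmn
    · simp [fockFamily, star_smul, hP, hPc]
    · rw [← star_eq_zero, star_mul, star_star]
      simp [fockFamily, star_smul, hP, hPc]
    · ext ξ w
      change (star (creator m.succPNat) * creator n.succPNat) ξ w = 0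
      rw [mul_apply_eq_comp, star_creator_apply]
      split_ifs with h
      · rw [creator_apply_cons, if_neg]
        intro e
        exact hmn (congrArg (· + 1) (Nat.succPNat_injective e))
      · rfl
  · rintro (_ | n)
    · rw [h00]
      simp [h00']
    · rw [Finset.sum_range_succ', h00']
      change star (creator n.succPNat) * creator n.succPNat
        = ∑ k ∈ Finset.range (n + 1), creator k.succPNat * star (creator k.succPNat) + vacuumProj
      ext ξ w
      rw [hsrc, add_apply, sum_apply, lp.coeFn_add,
        Pi.add_apply, lp.coeFn_sum, Finset.sum_apply, vacuumProj_apply, lp.coeFn_smul,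
        Pi.smul_apply]
      obtain ⟨_ | ⟨j, l⟩, h⟩ := w
      · have h0 : ∀ k ∈ Finset.range (n + 1),
            (creator k.succPNat * star (creator k.succPNat)) ξ ⟨[], h⟩ = 0 := fun k _ => rfl
        have h1 := Finset.sum_eq_zero h0
        rw [hV0, if_pos (List.isChain_singleton _)]
        refine Eq.trans ?_ (congrArg (· + _) h1.symm)
        simp
      · obtain ⟨m, rfl⟩ : ∃ m : ℕ, j = m.succPNat := ⟨j.natPred, j.succPNat_natPred.symm⟩
        simp only [hV, hrng, smul_zero, add_zero, Nat.succPNat_inj, Finset.sum_ite_eq,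
          Finset.mem_range]
        refine if_congr ?_ rfl rfl
        rw [List.isChain_cons_cons, and_iff_left h, ge_iff_le, Nat.succPNat_le_succPNat,
          Nat.lt_succ_iff]

/-- The representation of the universal algebra on the weakly monotone Fock space with
`s₀ ↦ z P_Ω` and `sᵢ ↦ Aᵢ†` for `i ≥ 1`. -/
def fockRep (z : Circle) : UniversalAlgebra →⋆ₙₐ[ℂ] (Fock →L[ℂ] Fock) :=
  UniversalAlgebra.lift (fockFamily z) (isFamily_fockFamily z)

theorem fockRep_gen_zero (z : Circle) :
    fockRep z (UniversalAlgebra.gen 0) = (z : ℂ) • vacuumProj := rfl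

theorem fockRep_gen_pos (z : Circle) (i : ℕ+) :
    fockRep z (UniversalAlgebra.gen i) = creator i := by
  obtain ⟨n, rfl⟩ : ∃ n : ℕ, i = n.succPNat := ⟨i.natPred, i.succPNat_natPred.symm⟩
  rfl

end WeaklyMonotone

end

/-! The algebra has polynomial growth, and this forces the norm of a ⋆-polynomial `b` in the
generators to be at most the supremum `C` over `z` of the norms of its Fock images. Since `sᵢ sⱼ =
0` for `i < j`, only monomials `s_μ s_ν⋆` with weakly decreasing words survive, and words with
letters at most `n` are polynomially many in their length. Length bounds add under products
(`IsFamily.mul_mem_monomialSpan`), so `(b⋆b)^(2^k)` involves a number of monomials polynomial in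
`2^k`.

The coefficients are controlled in the Fock representations. By `sᵢ = ∑_{k ≤ i} sᵢ sₖ sₖ⋆`, the
shorter words of all monomials can be given a common length `L`. A matrix entry is then a Laurent
polynomial in `z`: the basis vectors detect the nonzero letters, and the power of `z` the surplus of
zeros (`inner_monomial_fockFamily_of_longPair`, `eq_of_longPair`). Integration over the circle
bounds each coefficient. One phase would not do: it identifies `s₀` with `z s₀ s₀⋆`.

Thus `‖b⋆b‖^(2^k)` is at most a polynomial in `2^k` times `(C²)^(2^k)`. Taking roots removes the
polynomial (`IsFamily.norm_le_of_forall_norm_le`), and density concludes. -/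

namespace WeaklyMonotone

/-! ### Monomials and their length bounds. -/

section Monomials

variable {B : Type*} [CStarAlgebra B] {t : ℕ → B}

theorem IsFamily.source_mul_of_le (ht : IsFamily t) {i j : ℕ} (hij : j ≤ i) :
    star (t i) * t i * t j = t j := by
  rw [ht.source_eq, Finset.sum_mul, Finset.sum_eq_single_of_mem j (by simpa [Nat.lt_succ_iff])]
  · exact ht.partialIsometry j
  · intro k _ hk
    rw [mul_assoc, ht.orthogonal k j hk, mul_zero]

theorem IsFamily.source_mul_of_lt (ht : IsFamily t) {i j : ℕ} (hij : i < j) :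
    star (t i) * t i * t j = 0 := by
  rw [ht.source_eq, Finset.sum_mul]
  refine Finset.sum_eq_zero fun k hk => ?_
  rw [mul_assoc, ht.orthogonal k j (by have := Finset.mem_range.1 hk; omega), mul_zero]

theorem IsFamily.mul_source (ht : IsFamily t) (i : ℕ) : t i * (star (t i) * t i) = t i := by
  rw [← mul_assoc, ht.partialIsometry]

/-- The source projection of `t i` is orthogonal to the range of `t j`. Hence words with an ascent
vanish, which is the origin of polynomial growth. -/
theorem IsFamily.mul_eq_zero (ht : IsFamily t) {i j : ℕ} (hij : i < j) : t i * t j = 0 := by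
  rw [← ht.mul_source i, mul_assoc, ht.source_mul_of_lt hij, mul_zero]

/-- The monomial `s_μ s_ν⋆`. -/
noncomputable def monomial (t : ℕ → B) (μ ν : List ℕ) : B := (μ.map t).prod * star (ν.map t).prod

theorem star_monomial (μ ν : List ℕ) : star (monomial t μ ν) = monomial t ν μ := by
  simp [monomial]

theorem monomial_append (μ μ' ν ν' : List ℕ) :
    monomial t (μ ++ μ') (ν ++ ν') = (μ.map t).prod * monomial t μ' ν' * star (ν.map t).prod := by
  simp [monomial, mul_assoc]

theorem IsFamily.prod_eq_zero (ht : IsFamily t) {μ : List ℕ} (hμ : ¬ μ.IsChain (· ≥ ·)) :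
    (μ.map t).prod = 0 := by
  induction μ with
  | nil => exact absurd List.isChain_nil hμ
  | cons i μ ih =>
    by_cases h : μ.IsChain (· ≥ ·)
    · cases μ with
      | nil => exact absurd (List.isChain_singleton i) hμ
      | cons j μ =>
        have hij : i < j := by
          by_contra hc
          exact hμ (List.isChain_cons_cons.2 ⟨not_lt.1 hc, h⟩)
        rw [List.map_cons, List.map_cons, List.prod_cons, List.prod_cons, ← mul_assoc,
          ht.mul_eq_zero hij, zero_mul]
    · rw [List.map_cons, List.prod_cons, ih h, mul_zero]

theorem IsFamily.isChain_of_monomial_ne_zero (ht : IsFamily t) {μ ν : List ℕ}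
    (h : monomial t μ ν ≠ 0) : μ.IsChain (· ≥ ·) ∧ ν.IsChain (· ≥ ·) := by
  constructor <;> by_contra hc <;> apply h <;> simp [monomial, ht.prod_eq_zero hc]

theorem IsFamily.norm_monomial_le (ht : IsFamily t) (μ ν : List ℕ) : ‖monomial t μ ν‖ ≤ 1 := by
  cases subsingleton_or_nontrivial B with
  | inl h => simp [Subsingleton.elim (monomial t μ ν) 0]
  | inr h =>
    have key : ∀ μ : List ℕ, ‖(μ.map t).prod‖ ≤ 1 := by
      intro μ
      induction μ with
      | nil => simp
      | cons i μ ih =>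
        rw [List.map_cons, List.prod_cons]
        exact (norm_mul_le _ _).trans (mul_le_one₀ (ht.norm_le_one i) (norm_nonneg _) ih)
    refine (norm_mul_le _ _).trans (mul_le_one₀ (key μ) (norm_nonneg _) ?_)
    rw [norm_star]
    exact key ν

/-- Inserting the source projection of the last letter lengthens both words by one. The new letters
do not exceed `i`, so a bound on the letters persists. -/
theorem IsFamily.monomial_eq_sum (ht : IsFamily t) (μ : List ℕ) (i : ℕ) (ν : List ℕ) :
    monomial t (μ ++ [i]) ν
      = ∑ k ∈ Finset.range (i + 1), monomial t (μ ++ [i] ++ [k]) (ν ++ [k]) := by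
  have h : ∀ k, monomial t (μ ++ [i] ++ [k]) (ν ++ [k])
      = ((μ ++ [i]).map t).prod * (t k * star (t k)) * star (ν.map t).prod := fun k => by
    rw [monomial_append]; simp [monomial]
  simp_rw [h]
  rw [← Finset.sum_mul, ← Finset.mul_sum, ← ht.source_eq]
  simp only [monomial, List.map_append, List.prod_append, List.map_cons, List.map_nil,
    List.prod_singleton, mul_assoc (List.map t μ).prod, ht.mul_source]

/-- The span of the monomials `s_μ s_ν⋆` with letters at most `n` and `(μ, ν)` in a given set. -/
noncomputable def monomialSpan (t : ℕ → B) (n : ℕ) (R : List ℕ → List ℕ → Prop) : Submodule ℂ B :=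
  Submodule.span ℂ
    {x | ∃ μ ν, R μ ν ∧ (∀ i ∈ μ, i ≤ n) ∧ (∀ i ∈ ν, i ≤ n) ∧ monomial t μ ν = x}

theorem monomial_mem_monomialSpan {n : ℕ} {R : List ℕ → List ℕ → Prop} {μ ν : List ℕ}
    (h : R μ ν) (hμ : ∀ i ∈ μ, i ≤ n) (hν : ∀ i ∈ ν, i ≤ n) :
    monomial t μ ν ∈ monomialSpan t n R :=
  Submodule.subset_span ⟨μ, ν, h, hμ, hν, rfl⟩

/-- Non-empty words of length at most `d`. -/
def ShortPair (d : ℕ) (μ ν : List ℕ) : Prop :=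
  μ ≠ [] ∧ ν ≠ [] ∧ μ.length ≤ d ∧ ν.length ≤ d

theorem monomialSpan_shortPair_mono {n n' d d' : ℕ} (hn : n ≤ n') (hd : d ≤ d') :
    monomialSpan t n (ShortPair d) ≤ monomialSpan t n' (ShortPair d') := by
  refine Submodule.span_mono ?_
  rintro x ⟨μ, ν, ⟨h1, h2, h3, h4⟩, hμ, hν, rfl⟩
  exact ⟨μ, ν, ⟨h1, h2, h3.trans hd, h4.trans hd⟩, fun i hi => (hμ i hi).trans hn,
    fun i hi => (hν i hi).trans hn, rfl⟩

theorem star_mem_monomialSpan {n d : ℕ} {x : B} (hx : x ∈ monomialSpan t n (ShortPair d)) :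
    star x ∈ monomialSpan t n (ShortPair d) := by
  induction hx using Submodule.span_induction with
  | mem x hx =>
    obtain ⟨μ, ν, ⟨h1, h2, h3, h4⟩, hμ, hν, rfl⟩ := hx
    rw [star_monomial]
    exact monomial_mem_monomialSpan ⟨h2, h1, h4, h3⟩ hν hμ
  | zero => simp
  | add x y _ _ hx hy => rw [star_add]; exact add_mem hx hy
  | smul c x _ hx => rw [star_smul]; exact Submodule.smul_mem _ _ hx

/-- Facing letters cancel: distinct ones give zero, and equal ones leave a source projection that a
neighbouring letter either absorbs or is killed by. The projection has to be expanded only when no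
neighbour is left, so lengths never grow. -/
theorem IsFamily.star_prod_mul_prod_mem (ht : IsFamily t) {n : ℕ} (ν α : List ℕ)
    (hν : ∀ i ∈ ν, i ≤ n) (hα : ∀ i ∈ α, i ≤ n) :
    star (ν.map t).prod * (α.map t).prod
      ∈ monomialSpan t n fun x y => x.length ≤ α.length ∧ y.length ≤ ν.length := by
  induction ν generalizing α with
  | nil =>
    simpa [monomial] using monomial_mem_monomialSpan (t := t) (n := n) (μ := α) (ν := [])
      (R := fun x y => x.length ≤ α.length ∧ y.length ≤ 0) (by simp) hα (by simp)
  | cons i ν ih =>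
    cases α with
    | nil =>
      simpa [monomial] using monomial_mem_monomialSpan (t := t) (n := n) (μ := []) (ν := i :: ν)
        (R := fun x y => x.length ≤ 0 ∧ y.length ≤ ν.length + 1) (by simp) (by simp) hν
    | cons j α =>
      have hν' : ∀ k ∈ ν, k ≤ n := fun k hk => hν k (List.mem_cons_of_mem _ hk)
      have hα' : ∀ k ∈ α, k ≤ n := fun k hk => hα k (List.mem_cons_of_mem _ hk)
      have hi : i ≤ n := hν i List.mem_cons_self
      have hstep : star ((i :: ν).map t).prod * ((j :: α).map t).prod
          = star (ν.map t).prod * (star (t i) * t j) * (α.map t).prod := by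
        simp [mul_assoc]
      rw [hstep]
      by_cases hij : i = j
      · subst hij
        have hmono : monomialSpan t n (fun x y => x.length ≤ α.length ∧ y.length ≤ ν.length) ≤
            monomialSpan t n
              (fun x y => x.length ≤ (i :: α).length ∧ y.length ≤ (i :: ν).length) := by
          refine Submodule.span_mono ?_
          rintro x ⟨μ, ν, ⟨h1, h2⟩, h⟩
          exact ⟨μ, ν, ⟨h1.trans (by simp), h2.trans (by simp)⟩, h⟩
        cases α with
        | cons k α =>
          rw [mul_assoc, List.map_cons, List.prod_cons, ← mul_assoc (star (t i) * t i)]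
          rcases le_or_gt k i with hk | hk
          · rw [ht.source_mul_of_le hk]
            simpa using hmono (ih (k :: α) hν' hα')
          · rw [ht.source_mul_of_lt hk]
            simp
        | nil =>
          cases ν with
          | nil =>
            simp only [List.map_nil, List.prod_nil, star_one, one_mul, mul_one]
            rw [ht.source_eq]
            refine sum_mem fun k hk => ?_
            have hk : k ≤ n := by have := Finset.mem_range.1 hk; omega
            simpa [monomial] using monomial_mem_monomialSpan (t := t) (n := n) (μ := [k])
              (ν := [k]) (R := fun x y => x.length ≤ 1 ∧ y.length ≤ 1) (by simp) (by simpa)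
              (by simpa)
          | cons k ν =>
            have hs : star ((k :: ν).map t).prod * (star (t i) * t i) * (List.map t []).prod
                = star (ν.map t).prod * star (star (t i) * t i * t k) := by
              simp [mul_assoc]
            rw [hs]
            rcases le_or_gt k i with hk | hk
            · rw [ht.source_mul_of_le hk]
              simpa using hmono (ih [] hν' (by simp))
            · rw [ht.source_mul_of_lt hk]
              simp
      · rw [ht.orthogonal i j hij]
        simp

/-- In `s_μ (s_ν⋆ s_α) s_β⋆` the reduced middle factor appends at most `|α|` letters to `μ` and at
most `|ν|` to `β`. -/
theorem IsFamily.mul_mem_monomialSpan (ht : IsFamily t) {n d d' : ℕ} {x y : B}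
    (hx : x ∈ monomialSpan t n (ShortPair d)) (hy : y ∈ monomialSpan t n (ShortPair d')) :
    x * y ∈ monomialSpan t n (ShortPair (d + d')) := by
  induction hx using Submodule.span_induction with
  | zero => simp
  | add x x' _ _ hx hx' => rw [add_mul]; exact add_mem hx hx'
  | smul c x _ hx => rw [smul_mul_assoc]; exact Submodule.smul_mem _ _ hx
  | mem x hx =>
    induction hy using Submodule.span_induction with
    | zero => simp
    | add y y' _ _ hy hy' => rw [mul_add]; exact add_mem hy hy'
    | smul c y _ hy => rw [mul_smul_comm]; exact Submodule.smul_mem _ _ hy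
    | mem y hy =>
      obtain ⟨μ, ν, ⟨hμ0, hν0, hμd, hνd⟩, hμ, hν, rfl⟩ := hx
      obtain ⟨α, β, ⟨hα0, hβ0, hαd, hβd⟩, hα, hβ, rfl⟩ := hy
      have h := ht.star_prod_mul_prod_mem ν α hν hα
      have he : monomial t μ ν * monomial t α β
          = (μ.map t).prod * (star (ν.map t).prod * (α.map t).prod) * star (β.map t).prod := by
        simp [monomial, mul_assoc]
      rw [he]
      clear he
      generalize star (ν.map t).prod * (α.map t).prod = z at h
      induction h using Submodule.span_induction with
      | zero => simp
      | add z z' _ _ hz hz' => rw [mul_add, add_mul]; exact add_mem hz hz'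
      | smul c z _ hz => rw [mul_smul_comm, smul_mul_assoc]; exact Submodule.smul_mem _ _ hz
      | mem z hz =>
        obtain ⟨a, b, ⟨h1, h2⟩, ha, hb, rfl⟩ := hz
        rw [← monomial_append]
        refine monomial_mem_monomialSpan ⟨by simp [hμ0], by simp [hβ0], ?_, ?_⟩ ?_ ?_
        · rw [List.length_append]; omega
        · rw [List.length_append]; omega
        · intro i hi
          exact (List.mem_append.1 hi).elim (hμ i) (ha i)
        · intro i hi
          exact (List.mem_append.1 hi).elim (hβ i) (hb i)

theorem IsFamily.exists_mem_monomialSpan (ht : IsFamily t) {x : B}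
    (hx : x ∈ NonUnitalStarAlgebra.adjoin ℂ (Set.range t)) :
    ∃ n d, x ∈ monomialSpan t n (ShortPair d) := by
  induction hx using NonUnitalStarAlgebra.adjoin_induction with
  | mem x hx =>
    obtain ⟨i, rfl⟩ := hx
    -- The second word of `t i` is empty; one expansion gives lengths 2 and 1.
    refine ⟨i, 2, ?_⟩
    have h := ht.monomial_eq_sum [] i []
    have h' : monomial t ([] ++ [i]) [] = t i := by simp [monomial]
    rw [← h', h]
    refine sum_mem fun k hk => ?_
    have hk : k ≤ i := by have := Finset.mem_range.1 hk; omega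
    exact monomial_mem_monomialSpan (by simp [ShortPair])
      (by simpa) (by simpa)
  | zero => exact ⟨0, 0, zero_mem _⟩
  | add x y _ _ hx hy =>
    obtain ⟨n, d, hx⟩ := hx
    obtain ⟨n', d', hy⟩ := hy
    exact ⟨max n n', max d d', add_mem
      (monomialSpan_shortPair_mono (le_max_left _ _) (le_max_left _ _) hx)
      (monomialSpan_shortPair_mono (le_max_right _ _) (le_max_right _ _) hy)⟩
  | mul x y _ _ hx hy =>
    obtain ⟨n, d, hx⟩ := hx
    obtain ⟨n', d', hy⟩ := hy
    exact ⟨max n n', d + d', ht.mul_mem_monomialSpan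
      (monomialSpan_shortPair_mono (le_max_left _ _) le_rfl hx)
      (monomialSpan_shortPair_mono (le_max_right _ _) le_rfl hy)⟩
  | smul c x _ hx =>
    obtain ⟨n, d, hx⟩ := hx
    exact ⟨n, d, Submodule.smul_mem _ _ hx⟩
  | star x _ hx =>
    obtain ⟨n, d, hx⟩ := hx
    exact ⟨n, d, star_mem_monomialSpan hx⟩

theorem IsFamily.pow_mem_monomialSpan (ht : IsFamily t) {n d : ℕ} {x : B}
    (hx : x ∈ monomialSpan t n (ShortPair d)) (m : ℕ) :
    x ^ (m + 1) ∈ monomialSpan t n (ShortPair (d * (m + 1))) := by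
  induction m with
  | zero => simpa using hx
  | succ m ih =>
    rw [pow_succ, mul_add d (m + 1) 1, mul_one]
    exact ht.mul_mem_monomialSpan ih hx

/-- Words of length at most `2 * L`, the shorter one of length `L`. -/
def LongPair (L : ℕ) (μ ν : List ℕ) : Prop :=
  min μ.length ν.length = L ∧ μ.length ≤ 2 * L ∧ ν.length ≤ 2 * L

/-- Iterates `IsFamily.monomial_eq_sum` at the last letter of `μ`, so only `μ` has to be non-empty.
-/
theorem IsFamily.monomial_mem_monomialSpan_length (ht : IsFamily t) {n : ℕ} (j : ℕ)
    (μ ν : List ℕ) (h0 : μ ≠ []) (hμ : ∀ i ∈ μ, i ≤ n) (hν : ∀ i ∈ ν, i ≤ n) :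
    monomial t μ ν
      ∈ monomialSpan t n fun x y => x.length = μ.length + j ∧ y.length = ν.length + j := by
  induction j generalizing μ ν with
  | zero => exact monomial_mem_monomialSpan ⟨rfl, rfl⟩ hμ hν
  | succ j ih =>
    obtain ⟨μ', i, rfl⟩ : ∃ μ' i, μ = μ' ++ [i] :=
      ⟨μ.dropLast, μ.getLast h0, (List.dropLast_append_getLast h0).symm⟩
    rw [ht.monomial_eq_sum]
    refine sum_mem fun k hk => ?_
    have hk : k ≤ n := by
      have := Finset.mem_range.1 hk
      have := hμ i (by simp)
      omega
    have h := ih (μ' ++ [i] ++ [k]) (ν ++ [k]) (by simp)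
      (fun x hx => (List.mem_append.1 hx).elim (hμ x) (by simpa using fun e => e ▸ hk))
      (fun x hx => (List.mem_append.1 hx).elim (hν x) (by simpa using fun e => e ▸ hk))
    refine Submodule.span_mono ?_ h
    rintro x ⟨a, b, ⟨h1, h2⟩, h⟩
    simp only [List.length_append, List.length_singleton] at h1 h2
    exact ⟨a, b, ⟨by simp; omega, by omega⟩, h⟩

/-- Expanding `L - min` times brings the shorter word to length `L` and the longer one to at most `2
* L`. -/
theorem IsFamily.monomialSpan_shortPair_le (ht : IsFamily t) (n L : ℕ) :
    monomialSpan t n (ShortPair L) ≤ monomialSpan t n (LongPair L) := by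
  refine Submodule.span_le.2 ?_
  rintro x ⟨μ, ν, ⟨h1, h2, h3, h4⟩, hμ, hν, rfl⟩
  refine Submodule.span_mono ?_
    (ht.monomial_mem_monomialSpan_length (L - min μ.length ν.length) μ ν h1 hμ hν)
  rintro x ⟨a, b, ⟨h1, h2⟩, h⟩
  exact ⟨a, b, ⟨by omega, by omega, by omega⟩, h⟩

end Monomials

/-! ### Counting decreasing words. -/

/-- The weakly decreasing words with letters at most `n` and length at most `M`. -/
def decreasingWords (n M : ℕ) : Set (List ℕ) :=
  {μ | μ.IsChain (· ≥ ·) ∧ (∀ i ∈ μ, i ≤ n) ∧ μ.length ≤ M}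

theorem eq_of_isChain_of_count_eq {μ ν : List ℕ} (hμ : μ.IsChain (· ≥ ·))
    (hν : ν.IsChain (· ≥ ·)) (h : ∀ i, μ.count i = ν.count i) : μ = ν :=
  List.Perm.eq_of_pairwise' (List.isChain_iff_pairwise.1 hμ) (List.isChain_iff_pairwise.1 hν)
    (List.perm_iff_count.2 h)

theorem exists_finset_decreasingWords (n M : ℕ) :
    ∃ W : Finset (List ℕ), (W : Set (List ℕ)) = decreasingWords n M ∧
      W.card ≤ (M + 1) ^ (n + 1) := by
  -- A decreasing word is determined by its multiplicities. Reduction modulo `M + 1` loses nothing,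
  -- as a multiplicity is at most the length.
  let f : List ℕ → (Fin (n + 1) → Fin (M + 1)) := fun μ i => Fin.ofNat (M + 1) (μ.count i.1)
  have hf : Set.InjOn f (decreasingWords n M) := by
    rintro μ ⟨h1, h2, h3⟩ ν ⟨k1, k2, k3⟩ h
    refine eq_of_isChain_of_count_eq h1 k1 fun i => ?_
    by_cases hi : i ≤ n
    · have h' := congrArg Fin.val (congrFun h ⟨i, Nat.lt_succ_of_le hi⟩)
      have e1 := (List.count_le_length (a := i) (l := μ)).trans h3
      have e2 := (List.count_le_length (a := i) (l := ν)).trans k3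
      simpa [f, Nat.mod_eq_of_lt (Nat.lt_succ_of_le e1),
        Nat.mod_eq_of_lt (Nat.lt_succ_of_le e2)] using h'
    · rw [List.count_eq_zero.2 fun hm => hi (h2 i hm), List.count_eq_zero.2 fun hm => hi (k2 i hm)]
  have hfin : (decreasingWords n M).Finite := Set.Finite.of_injOn (Set.mapsTo_univ f _) hf
    Set.finite_univ
  refine ⟨hfin.toFinset, hfin.coe_toFinset, ?_⟩
  have := Finset.card_le_card_of_injOn (s := hfin.toFinset) (t := Finset.univ) f
    (fun _ _ => Finset.mem_coe.2 (Finset.mem_univ _)) (by simpa using hf)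
  simpa using this


/-! ### Deleting the letter zero. -/

section DropZeros

/-- The word in the letters `1, 2, …` obtained by deleting the zeros. -/
def dropZeros : List ℕ → List ℕ+
  | [] => []
  | 0 :: α => dropZeros α
  | (n + 1) :: α => n.succPNat :: dropZeros α

theorem length_dropZeros_add_count (α : List ℕ) :
    (dropZeros α).length + α.count 0 = α.length := by
  induction α with
  | nil => rfl
  | cons i α ih =>
    rcases i with _ | n
    · simp only [dropZeros, List.count_cons_self, List.length_cons]; omega
    · simp only [dropZeros, List.length_cons, List.count_cons_of_ne (Nat.succ_ne_zero n)]; omega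

theorem count_dropZeros (α : List ℕ) (n : ℕ) :
    (dropZeros α).count n.succPNat = α.count (n + 1) := by
  induction α with
  | nil => rfl
  | cons i α ih =>
    rcases i with _ | m
    · simp [dropZeros, ih]
    · simp [dropZeros, List.count_cons, ih]

theorem mem_of_mem_dropZeros {α : List ℕ} {j : ℕ+} (h : j ∈ dropZeros α) : (j : ℕ) ∈ α := by
  induction α with
  | nil => simp [dropZeros] at h
  | cons i α ih =>
    rcases i with _ | m
    · exact List.mem_cons_of_mem _ (ih h)
    · rcases List.mem_cons.1 h with rfl | h
      · simp
      · exact List.mem_cons_of_mem _ (ih h)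

theorem isChain_dropZeros {α : List ℕ} (h : α.IsChain (· ≥ ·)) :
    (dropZeros α).IsChain (· ≥ ·) := by
  rw [List.isChain_iff_pairwise] at h ⊢
  induction h with
  | nil => exact List.Pairwise.nil
  | @cons i α hi _ ih =>
    rcases i with _ | m
    · exact ih
    · exact List.Pairwise.cons (fun j hj => hi _ (mem_of_mem_dropZeros hj)) ih

theorem dropZeros_eq_nil_of_isChain {α : List ℕ} (h : (0 :: α).IsChain (· ≥ ·)) :
    dropZeros α = [] := by
  rw [List.isChain_iff_pairwise, List.pairwise_cons] at h
  refine List.eq_nil_iff_forall_not_mem.2 fun j hj => ?_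
  exact absurd (h.1 _ (mem_of_mem_dropZeros hj)) (not_le.2 j.pos)

/-- Deleting the zeros of a decreasing word, as a basis label. -/
def stripped (α : List ℕ) (h : α.IsChain (· ≥ ·)) : Word := ⟨dropZeros α, isChain_dropZeros h⟩

/-- Deleting zeros forgets only their numbers in the two words. Their difference is given by `hz`,
and the common minimal length `L` then fixes both. -/
theorem eq_of_longPair {L : ℕ} {α β α' β' : List ℕ} (hL : LongPair L α β)
    (hL' : LongPair L α' β') (hα : α.IsChain (· ≥ ·)) (hβ : β.IsChain (· ≥ ·))
    (hα' : α'.IsChain (· ≥ ·)) (hβ' : β'.IsChain (· ≥ ·)) (h : dropZeros α = dropZeros α')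
    (h' : dropZeros β = dropZeros β')
    (hz : (α.count 0 : ℤ) - β.count 0 = α'.count 0 - β'.count 0) : α = α' ∧ β = β' := by
  have e1 := length_dropZeros_add_count α
  have e2 := length_dropZeros_add_count β
  have e3 := length_dropZeros_add_count α'
  have e4 := length_dropZeros_add_count β'
  rw [h] at e1
  rw [h'] at e2
  obtain ⟨m1, -, -⟩ := hL
  obtain ⟨m2, -, -⟩ := hL'
  constructor
  · refine eq_of_isChain_of_count_eq hα hα' fun i => ?_
    rcases i with _ | n
    · omega
    · rw [← count_dropZeros, h, count_dropZeros]
  · refine eq_of_isChain_of_count_eq hβ hβ' fun i => ?_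
    rcases i with _ | n
    · omega
    · rw [← count_dropZeros, h', count_dropZeros]

end DropZeros

/-! ### Matrix entries of monomials on Fock space. -/

section MatrixCoefficients

theorem inner_basisVec_left (w : Word) (ξ : Fock) : inner ℂ (basisVec w) ξ = ξ w := by
  classical
  rw [basisVec, lp.inner_single_left]
  simp

theorem basisVec_apply (u w : Word) [Decidable (u = w)] :
    basisVec u w = if u = w then 1 else 0 := by
  split_ifs with h
  · subst h
    exact lp.single_apply_self _ _ _
  · exact lp.single_apply_ne _ _ _ (Ne.symm h)

theorem norm_basisVec (w : Word) : ‖basisVec w‖ = 1 := by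
  rw [basisVec, lp.norm_single (by norm_num)]; simp

theorem inner_vacuum_vacuum : inner ℂ vacuum vacuum = (1 : ℂ) := by
  rw [inner_self_eq_norm_sq_to_K, vacuum, norm_basisVec]; simp

theorem creator_basisVec {i : ℕ+} {w : Word} (h : (i :: w.1).IsChain (· ≥ ·)) :
    creator i (basisVec w) = basisVec ⟨i :: w.1, h⟩ := by
  simp [creator, basisVec, partialOp_single, prepend, h]

/-- The zeros of a decreasing word stand last, so they meet the vacuum first and contribute `z`
each; the creators then build the rest. -/
theorem prod_fockFamily_vacuum (z : Circle) {α : List ℕ} (h : α.IsChain (· ≥ ·)) :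
    (α.map (fockFamily z)).prod vacuum = (z : ℂ) ^ α.count 0 • basisVec (stripped α h) := by
  induction α with
  | nil => simp [stripped, dropZeros, vacuum]
  | cons i α ih =>
    rw [List.map_cons, List.prod_cons, mul_apply_eq_comp, ih h.tail, map_smul]
    rcases i with _ | n
    · have h0 : stripped α h.tail = ⟨[], List.isChain_nil⟩ :=
        Subtype.ext (dropZeros_eq_nil_of_isChain h)
      have h1 : stripped (0 :: α) h = ⟨[], List.isChain_nil⟩ :=
        Subtype.ext (show dropZeros α = [] from dropZeros_eq_nil_of_isChain h)
      rw [h0, h1, List.count_cons_self, pow_succ, mul_smul]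
      change _ • (z : ℂ) • vacuumProj (basisVec _) = _
      rw [vacuumProj_apply, basisVec_apply, if_pos rfl, one_smul, vacuum]
    · rw [List.count_cons_of_ne (Nat.succ_ne_zero n)]
      congr 1
      exact creator_basisVec (w := stripped α h.tail) (isChain_dropZeros h)

/-- Each adjoint strips the first letter, kills the vector or projects to the vacuum; `α` has enough
letters to exhaust `w`. -/
theorem star_prod_fockFamily_basisVec (z : Circle) (α : List ℕ) (w : Word)
    (h : w.1.length ≤ α.length) :
    ∃ c : ℂ, star (α.map (fockFamily z)).prod (basisVec w) = c • vacuum := by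
  induction α generalizing w with
  | nil =>
    obtain ⟨w, hw⟩ := w
    obtain rfl : w = [] := by simpa using h
    exact ⟨1, by simp [vacuum]⟩
  | cons i α ih =>
    rw [List.map_cons, List.prod_cons, star_mul, mul_apply_eq_comp]
    rcases i with _ | n
    · have hP : star vacuumProj = vacuumProj := isSelfAdjoint_starProjection _
      obtain ⟨c, hc⟩ := ih ⟨[], List.isChain_nil⟩ (by simp)
      change ∃ c : ℂ, star (α.map (fockFamily z)).prod
        (star ((z : ℂ) • vacuumProj) (basisVec w)) = _
      rw [star_smul, hP, smul_apply, vacuumProj_apply, map_smul, map_smul]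
      change ∃ c' : ℂ, _ • _ • star (α.map (fockFamily z)).prod (basisVec _) = _
      rw [hc, smul_smul, smul_smul]
      exact ⟨_, rfl⟩
    · obtain ⟨_ | ⟨j, l⟩, hw⟩ := w
      · refine ⟨0, ?_⟩
        have : star (fockFamily z (n + 1)) (basisVec ⟨[], hw⟩) = 0 := by
          change star (creator n.succPNat) (basisVec ⟨[], hw⟩) = 0
          simp [creator, star_partialOp, basisVec, partialOp_single, prepend, PEquiv.symm]
        rw [this, map_zero, zero_smul]
      · by_cases hj : j = n.succPNat
        · obtain ⟨c, hc⟩ := ih ⟨l, hw.tail⟩ (by simpa using h)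
          refine ⟨c, ?_⟩
          rw [← hc]
          congr 1
          change star (creator n.succPNat) (basisVec ⟨j :: l, hw⟩) = _
          simp [creator, star_partialOp, basisVec, partialOp_single, prepend, PEquiv.symm, hj]
        · refine ⟨0, ?_⟩
          have : star (fockFamily z (n + 1)) (basisVec ⟨j :: l, hw⟩) = 0 := by
            change star (creator n.succPNat) (basisVec ⟨j :: l, hw⟩) = 0
            simp [creator, star_partialOp, basisVec, partialOp_single, prepend, PEquiv.symm, hj]
          rw [this, map_zero, zero_smul]

theorem star_prod_fockFamily_basisVec_eq (z : Circle) (α : List ℕ) (w : Word)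
    (h : w.1.length ≤ α.length) :
    star (α.map (fockFamily z)).prod (basisVec w)
      = (inner ℂ ((α.map (fockFamily z)).prod vacuum) (basisVec w) : ℂ) • vacuum := by
  obtain ⟨c, hc⟩ := star_prod_fockFamily_basisVec z α w h
  -- The scalar is identified by pairing with the vacuum.
  rw [hc, ← ContinuousLinearMap.adjoint_inner_right, ← ContinuousLinearMap.star_eq_adjoint, hc,
    inner_smul_right, inner_vacuum_vacuum, mul_one]

/-- If one word is long enough to exhaust its basis vector, the monomial passes through the vacuum
line, and its entry is that of a rank-one operator. -/
theorem inner_monomial_fockFamily (z : Circle) (α β : List ℕ) (u w : Word)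
    (h : u.1.length ≤ α.length ∨ w.1.length ≤ β.length) :
    inner ℂ (basisVec u) (monomial (fockFamily z) α β (basisVec w))
      = inner ℂ (basisVec u) ((α.map (fockFamily z)).prod vacuum)
        * inner ℂ ((β.map (fockFamily z)).prod vacuum) (basisVec w) := by
  rw [monomial, mul_apply_eq_comp]
  rcases h with h | h
  · rw [← ContinuousLinearMap.adjoint_inner_left, ← ContinuousLinearMap.star_eq_adjoint,
      star_prod_fockFamily_basisVec_eq z α u h, inner_smul_left, inner_conj_symm,
      ContinuousLinearMap.star_eq_adjoint, ContinuousLinearMap.adjoint_inner_right]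
  · rw [star_prod_fockFamily_basisVec_eq z β w h, map_smul, inner_smul_right, mul_comm]

theorem inner_monomial_fockFamily_of_longPair (z : Circle) {L : ℕ} {α β α' β' : List ℕ}
    (hL : LongPair L α β) (hL' : LongPair L α' β') (hα : α.IsChain (· ≥ ·))
    (hβ : β.IsChain (· ≥ ·)) (hα' : α'.IsChain (· ≥ ·)) (hβ' : β'.IsChain (· ≥ ·)) :
    inner ℂ (basisVec (stripped α' hα'))
        (monomial (fockFamily z) α β (basisVec (stripped β' hβ')))
      = if dropZeros α = dropZeros α' ∧ dropZeros β = dropZeros β' then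
          (z : ℂ) ^ ((α.count 0 : ℤ) - β.count 0) else 0 := by
  classical
  have e1 := length_dropZeros_add_count α'
  have e2 := length_dropZeros_add_count β'
  rw [inner_monomial_fockFamily, prod_fockFamily_vacuum z hα, prod_fockFamily_vacuum z hβ,
    inner_smul_left, inner_smul_right, inner_basisVec_left, inner_basisVec_left, basisVec_apply,
    basisVec_apply]
  · have h1 : stripped α hα = stripped α' hα' ↔ dropZeros α = dropZeros α' := Subtype.ext_iff
    have h2 : stripped β' hβ' = stripped β hβ ↔ dropZeros β = dropZeros β' :=
      Subtype.ext_iff.trans eq_comm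
    have hz : (starRingEnd ℂ) (z : ℂ) = (z : ℂ)⁻¹ := by
      rw [← Circle.coe_inv_eq_conj, Circle.coe_inv]
    simp only [h1, h2]
    by_cases k1 : dropZeros α = dropZeros α' <;> by_cases k2 : dropZeros β = dropZeros β' <;>
      simp [k1, k2, hz, zpow_sub₀, div_eq_mul_inv]
  -- One of `α'`, `β'` has length `L`, while `α` and `β` both have length at least `L`.
  · obtain ⟨m1, -, -⟩ := hL
    obtain ⟨m2, -, -⟩ := hL'
    change (dropZeros α').length ≤ _ ∨ (dropZeros β').length ≤ _
    omega

end MatrixCoefficients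

/-! ### Fourier coefficients on the circle. -/

open scoped Real in
theorem integral_circle_zpow {n : ℤ} (hn : n ≠ 0) :
    ∫ θ in (0 : ℝ)..2 * π, ((Circle.exp θ : Circle) : ℂ) ^ n = 0 := by
  have hc : (n : ℂ) * Complex.I ≠ 0 := mul_ne_zero (by exact_mod_cast hn) Complex.I_ne_zero
  have h : ∀ θ : ℝ, ((Circle.exp θ : Circle) : ℂ) ^ n = Complex.exp (n * Complex.I * θ) := by
    intro θ
    rw [Circle.coe_exp, ← Complex.exp_int_mul]
    ring_nf
  simp_rw [h]
  rw [integral_exp_mul_complex hc]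
  have : Complex.exp (n * Complex.I * ((2 * π : ℝ) : ℂ)) = 1 := by
    rw [← Complex.exp_int_mul_two_pi_mul_I n]
    congr 1
    push_cast
    ring
  rw [this]
  simp

open scoped Real in
/-- A coefficient of a trigonometric polynomial is bounded by its supremum. -/
theorem norm_coeff_le_of_circle {ι : Type*} (S : Finset ι) (k : ι → ℂ) (n : ι → ℤ) {C : ℝ}
    (hC : ∀ z : Circle, ‖∑ i ∈ S, k i * (z : ℂ) ^ n i‖ ≤ C) {j : ι} (hj : j ∈ S)
    (hinj : ∀ i ∈ S, i ≠ j → k i = 0 ∨ n i ≠ n j) : ‖k j‖ ≤ C := by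
  have hpi : 0 < 2 * π := Real.two_pi_pos
  have hcont : ∀ m : ℤ, Continuous fun θ : ℝ => ((Circle.exp θ : Circle) : ℂ) ^ m := fun m =>
    (continuous_subtype_val.comp Circle.exp.continuous).zpow₀ m
      fun θ => Or.inl (Circle.coe_ne_zero _)
  have hI : ∫ θ in (0 : ℝ)..2 * π,
      ∑ i ∈ S, k i * ((Circle.exp θ : Circle) : ℂ) ^ (n i - n j) = (2 * π : ℝ) * k j := by
    rw [intervalIntegral.integral_finsetSum fun i _ =>
      ((hcont (n i - n j)).const_mul (k i)).intervalIntegrable _ _,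
      Finset.sum_eq_single_of_mem j hj]
    · simp [mul_comm]
    · intro i hi hij
      rw [intervalIntegral.integral_const_mul]
      rcases hinj i hi hij with h | h
      · rw [h, zero_mul]
      · rw [integral_circle_zpow (sub_ne_zero.2 h), mul_zero]
  have hb : ‖∫ θ in (0 : ℝ)..2 * π,
      ∑ i ∈ S, k i * ((Circle.exp θ : Circle) : ℂ) ^ (n i - n j)‖ ≤ C * |2 * π - 0| := by
    refine intervalIntegral.norm_integral_le_of_norm_le_const fun θ _ => ?_
    -- The shift of exponents is a unimodular factor, so the bound `C` is unaffected.
    have h : ∑ i ∈ S, k i * ((Circle.exp θ : Circle) : ℂ) ^ (n i - n j)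
        = (∑ i ∈ S, k i * ((Circle.exp θ : Circle) : ℂ) ^ n i)
          * (((Circle.exp θ) ^ (-n j) : Circle) : ℂ) := by
      rw [Finset.sum_mul]
      refine Finset.sum_congr rfl fun i _ => ?_
      rw [sub_eq_add_neg, zpow_add₀ (Circle.coe_ne_zero _), Circle.coe_zpow, mul_assoc]
    rw [h, norm_mul, Circle.norm_coe, mul_one]
    exact hC _
  rw [hI, norm_mul, Complex.norm_real, Real.norm_eq_abs, sub_zero, mul_comm C] at hb
  exact le_of_mul_le_mul_left hb (abs_pos.2 hpi.ne')


/-! ### The norm estimate. -/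

section Estimate

variable {B : Type*} [CStarAlgebra B] {t : ℕ → B}

theorem map_monomial {B' : Type*} [CStarAlgebra B'] (φ : B →⋆ₐ[ℂ] B') (μ ν : List ℕ) :
    φ (monomial t μ ν) = monomial (fun i => φ (t i)) μ ν := by
  simp [monomial, map_list_prod, map_star, Function.comp_def]

theorem norm_map_star_mul_self_pow_le {B' : Type*} [CStarAlgebra B'] (φ : B →⋆ₐ[ℂ] B') (b : B)
    (m : ℕ) : ‖φ ((star b * b) ^ (m + 1))‖ ≤ (‖φ b‖ ^ 2) ^ (m + 1) := by
  rw [map_pow, map_mul, map_star, pow_two ‖φ b‖, ← CStarRing.norm_star_mul_self]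
  exact norm_pow_le' _ m.succ_pos

/-- Monomials with a non-decreasing-order word vanish, so pairs of decreasing words of length at
most `2 * L` suffice; the doubled exponent counts pairs. -/
theorem IsFamily.exists_sum_eq_of_mem_monomialSpan (ht : IsFamily t) {n L : ℕ} {c : B}
    (hc : c ∈ monomialSpan t n (LongPair L)) :
    ∃ (S : Finset (List ℕ × List ℕ)) (k : List ℕ × List ℕ → ℂ),
      S.card ≤ (2 * L + 1) ^ (2 * (n + 1)) ∧
      (∀ p ∈ S, LongPair L p.1 p.2 ∧ p.1.IsChain (· ≥ ·) ∧ p.2.IsChain (· ≥ ·)) ∧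
      ∑ p ∈ S, k p • monomial t p.1 p.2 = c := by
  classical
  obtain ⟨W, hW, hcard⟩ := exists_finset_decreasingWords n (2 * L)
  have hW' : ∀ μ, μ ∈ W ↔ μ ∈ decreasingWords n (2 * L) := fun μ => by
    rw [← hW, Finset.mem_coe]
  let S := (W ×ˢ W).filter fun p => LongPair L p.1 p.2
  have hS : ∀ p ∈ S, LongPair L p.1 p.2 ∧ p.1.IsChain (· ≥ ·) ∧ p.2.IsChain (· ≥ ·) := by
    intro p hp
    obtain ⟨h1, h2⟩ := Finset.mem_filter.1 hp
    obtain ⟨h3, h4⟩ := Finset.mem_product.1 h1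
    exact ⟨h2, ((hW' _).1 h3).1, ((hW' _).1 h4).1⟩
  have hle : monomialSpan t n (LongPair L)
      ≤ Submodule.span ℂ ((fun p : List ℕ × List ℕ => monomial t p.1 p.2) '' (S : Set _)) := by
    refine Submodule.span_le.2 ?_
    rintro x ⟨μ, ν, h, hμ, hν, rfl⟩
    by_cases h0 : monomial t μ ν = 0
    · rw [h0]; exact zero_mem _
    · obtain ⟨h1, h2⟩ := ht.isChain_of_monomial_ne_zero h0
      refine Submodule.subset_span ⟨(μ, ν), Finset.mem_coe.2 (Finset.mem_filter.2 ⟨?_, h⟩), rfl⟩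
      exact Finset.mem_product.2 ⟨(hW' _).2 ⟨h1, hμ, h.2.1⟩, (hW' _).2 ⟨h2, hν, h.2.2⟩⟩
  obtain ⟨k, hk⟩ := (Submodule.mem_span_image_finset_iff_exists_fun ℂ).1 (hle hc)
  refine ⟨S, fun p => if h : p ∈ S then k ⟨p, h⟩ else 0, ?_, hS, ?_⟩
  swap
  · rw [← hk, ← Finset.sum_coe_sort]
    exact Finset.sum_congr rfl fun p _ => congrArg (· • _) (dif_pos p.2)
  calc S.card ≤ (W ×ˢ W).card := Finset.card_filter_le _ _
    _ = W.card * W.card := Finset.card_product _ _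
    _ ≤ (2 * L + 1) ^ (n + 1) * (2 * L + 1) ^ (n + 1) := Nat.mul_le_mul hcard hcard
    _ = (2 * L + 1) ^ (2 * (n + 1)) := by rw [← pow_add, two_mul (n + 1)]

/-- On elements of bounded length the norm is dominated by the norms in the Fock representations, up
to a factor of polynomial growth. -/
theorem IsFamily.norm_le_card_mul (ht : IsFamily t) (φ : Circle → B →⋆ₐ[ℂ] (Fock →L[ℂ] Fock))
    (hφ : ∀ z i, φ z (t i) = fockFamily z i) {n L : ℕ} {c : B}
    (hc : c ∈ monomialSpan t n (LongPair L)) {C : ℝ} (hC : ∀ z, ‖φ z c‖ ≤ C) :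
    ‖c‖ ≤ (2 * L + 1) ^ (2 * (n + 1)) * C := by
  classical
  obtain ⟨S, k, hcard, hS, rfl⟩ := ht.exists_sum_eq_of_mem_monomialSpan hc
  have hC0 : 0 ≤ C := (norm_nonneg _).trans (hC 1)
  have hk : ∀ p ∈ S, ‖k p‖ ≤ C := by
    rintro ⟨α', β'⟩ hp
    obtain ⟨hL', hα', hβ'⟩ := hS _ hp
    -- Keeps the coefficients that the matrix entry at the stripped words of `α'`, `β'` can see.
    let k' : List ℕ × List ℕ → ℂ := fun q =>
      if dropZeros q.1 = dropZeros α' ∧ dropZeros q.2 = dropZeros β' then k q else 0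
    have hk' : k' (α', β') = k (α', β') := if_pos ⟨rfl, rfl⟩
    rw [← hk']
    refine norm_coeff_le_of_circle S k'
      (fun q => (q.1.count 0 : ℤ) - q.2.count 0) (fun z => ?_) hp fun q hq hne => ?_
    · have h : ∑ q ∈ S, k' q * (z : ℂ) ^ ((q.1.count 0 : ℤ) - q.2.count 0)
          = inner ℂ (basisVec (stripped α' hα'))
            (φ z (∑ p ∈ S, k p • monomial t p.1 p.2) (basisVec (stripped β' hβ'))) := by
        rw [map_sum, sum_apply, inner_sum]
        refine Finset.sum_congr rfl fun q hq => ?_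
        obtain ⟨hL, hα, hβ⟩ := hS q hq
        have hm : φ z (monomial t q.1 q.2) = monomial (fockFamily z) q.1 q.2 := by
          rw [map_monomial]
          congr 1
          exact funext (hφ z)
        rw [map_smul, hm, smul_apply, inner_smul_right,
          inner_monomial_fockFamily_of_longPair z hL hL' hα hβ hα' hβ']
        simp only [k']
        split_ifs <;> simp
      rw [h]
      refine (norm_inner_le_norm _ _).trans ?_
      rw [norm_basisVec, one_mul]
      refine ((φ z _).le_opNorm _).trans ?_
      rw [norm_basisVec, mul_one]
      exact hC z
    -- Among the coefficients kept, distinct pairs have distinct exponents.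
    · by_cases hd : dropZeros q.1 = dropZeros α' ∧ dropZeros q.2 = dropZeros β'
      · refine Or.inr fun he => hne ?_
        obtain ⟨hL, hα, hβ⟩ := hS q hq
        obtain ⟨e1, e2⟩ := eq_of_longPair hL hL' hα hβ hα' hβ' hd.1 hd.2 he
        exact Prod.ext e1 e2
      · exact Or.inl (if_neg hd)
  calc ‖∑ p ∈ S, k p • monomial t p.1 p.2‖ ≤ ∑ p ∈ S, C := by
        refine norm_sum_le_of_le S fun p hp => ?_
        rw [norm_smul]
        exact (mul_le_of_le_one_right (norm_nonneg _) (ht.norm_monomial_le _ _)).trans (hk p hp)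
    _ = S.card * C := by rw [Finset.sum_const, nsmul_eq_mul]
    _ ≤ (2 * L + 1) ^ (2 * (n + 1)) * C := by
        refine mul_le_mul_of_nonneg_right ?_ hC0
        exact_mod_cast hcard

/-- If `x > y`, the powers of `x / y` would outgrow every polynomial in `2 ^ k`. -/
theorem le_of_pow_two_pow_le {x y : ℝ} (hy : 0 < y) (a r : ℕ)
    (h : ∀ k : ℕ, x ^ 2 ^ k ≤ (2 * ((a * 2 ^ k : ℕ) : ℝ) + 1) ^ r * y ^ 2 ^ k) : x ≤ y := by
  by_contra! hlt
  have hq : 1 < x / y := (one_lt_div hy).2 hlt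
  have hlim := ((tendsto_pow_const_div_const_pow_of_one_lt r hq).const_mul
    ((2 * (a : ℝ) + 1) ^ r)).comp (tendsto_pow_atTop_atTop_of_one_lt (one_lt_two (α := ℕ)))
  rw [mul_zero] at hlim
  obtain ⟨k, hk⟩ := (hlim.eventually_lt_const one_pos).exists
  simp only [Function.comp_apply] at hk
  have hpos : 0 < (x / y) ^ 2 ^ k := pow_pos (one_pos.trans hq) _
  rw [← mul_div_assoc, div_lt_one hpos, div_pow, lt_div_iff₀ (by positivity)] at hk
  refine absurd (h k) (not_le.2 (lt_of_le_of_lt ?_ hk))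
  refine mul_le_mul_of_nonneg_right ?_ (by positivity)
  rw [← mul_pow]
  refine pow_le_pow_left₀ (by positivity) ?_ r
  -- This gives `2 * a * 2 ^ k + 1 ≤ (2 * a + 1) * 2 ^ k`.
  have h1 : (1 : ℝ) ≤ 2 ^ k := one_le_pow₀ one_le_two
  push_cast
  nlinarith

/-- For the self-adjoint `star b * b` the norm of a `2 ^ k`-th power is the power of the norm, so
the polynomial factor at `L = d * 2 ^ k` disappears in the limit. -/
theorem IsFamily.norm_le_of_forall_norm_le (ht : IsFamily t)
    (φ : Circle → B →⋆ₐ[ℂ] (Fock →L[ℂ] Fock)) (hφ : ∀ z i, φ z (t i) = fockFamily z i) {b : B}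
    (hb : b ∈ NonUnitalStarAlgebra.adjoin ℂ (Set.range t)) {C : ℝ} (hC0 : 0 < C)
    (hC : ∀ z, ‖φ z b‖ ≤ C) : ‖b‖ ≤ C := by
  obtain ⟨n, d, hd⟩ := ht.exists_mem_monomialSpan (mul_mem (star_mem hb) hb)
  have hsa : IsSelfAdjoint (star b * b) := IsSelfAdjoint.star_mul_self b
  have h : ‖star b * b‖ ≤ C ^ 2 := by
    refine le_of_pow_two_pow_le (by positivity) d (2 * (n + 1)) fun k => ?_
    rw [← hsa.norm_pow_two_pow]
    obtain ⟨m, hm⟩ : ∃ m, 2 ^ k = m + 1 := Nat.exists_eq_add_one.2 (by positivity)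
    rw [hm]
    refine ht.norm_le_card_mul φ hφ
      (ht.monomialSpan_shortPair_le _ _ (ht.pow_mem_monomialSpan hd m)) fun z => ?_
    exact (norm_map_star_mul_self_pow_le (φ z) b m).trans
      (pow_le_pow_left₀ (by positivity) (pow_le_pow_left₀ (norm_nonneg _) (hC z) 2) _)
  rw [CStarRing.norm_star_mul_self, ← pow_two] at h
  exact le_of_sq_le_sq h hC0.le

end Estimate

/-! ### Passage to the universal algebra. -/

section Faithful

open UniversalAlgebra

/-- Monomials with an empty word need a unit, so the estimate is made in the unitization, which
contains the algebra isometrically. -/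
theorem norm_le_of_mem_adjoin_gen {b : UniversalAlgebra}
    (hb : b ∈ NonUnitalStarAlgebra.adjoin ℂ (Set.range gen)) {C : ℝ} (hC0 : 0 < C)
    (hC : ∀ z, ‖fockRep z b‖ ≤ C) : ‖b‖ ≤ C := by
  let ι : UniversalAlgebra →⋆ₙₐ[ℂ] Unitization ℂ UniversalAlgebra :=
    Unitization.inrNonUnitalStarAlgHom ℂ UniversalAlgebra
  have ht : IsFamily fun i => ι (gen i) :=
    ⟨fun i => by simpa only [map_mul, map_star] using congrArg ι (isFamily_gen.partialIsometry i),
      fun i j h => by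
        simpa only [map_mul, map_star, map_zero] using congrArg ι (isFamily_gen.orthogonal i j h),
      fun i => by
        simpa only [map_mul, map_star, map_sum] using congrArg ι (isFamily_gen.source_eq i)⟩
  let φ : Circle → Unitization ℂ UniversalAlgebra →⋆ₐ[ℂ] (Fock →L[ℂ] Fock) := fun z =>
    Unitization.starLift (fockRep z)
  have hφ : ∀ z (x : UniversalAlgebra), φ z (ι x) = fockRep z x := fun z x => by
    have h := Unitization.starLift_symm_apply_apply (φ z) x
    rw [Equiv.symm_apply_apply] at h
    exact h.symm
  have hmem : ι b ∈ NonUnitalStarAlgebra.adjoin ℂ (Set.range fun i => ι (gen i)) := by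
    have h : (Set.range fun i => ι (gen i)) = ι '' Set.range gen := Set.range_comp ι gen
    rw [h, ← NonUnitalStarAlgHom.map_adjoin]
    exact ⟨b, hb, rfl⟩
  have h := ht.norm_le_of_forall_norm_le φ (fun z i => hφ z (gen i)) hmem hC0
    fun z => (hφ z b).symm ▸ hC z
  rwa [show ‖ι b‖ = ‖b‖ from Unitization.norm_inr b] at h

theorem dense_adjoin_gen (x : UniversalAlgebra) {ε : ℝ} (hε : 0 < ε) :
    ∃ b ∈ NonUnitalStarAlgebra.adjoin ℂ (Set.range gen), ‖x - b‖ < ε := by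
  obtain ⟨y, hy, hxy⟩ := Metric.mem_closure_iff.1
    (show (x : Ambient) ∈ closure
      (NonUnitalStarAlgebra.adjoin ℂ (Set.range ambientGen) : Set Ambient) from x.2) ε hε
  have h : (Set.range ambientGen : Set Ambient)
      = NonUnitalStarSubalgebraClass.subtype universalSubalgebra '' Set.range gen := by
    rw [← Set.range_comp]; rfl
  rw [h, ← NonUnitalStarAlgHom.map_adjoin] at hy
  obtain ⟨b, hb, rfl⟩ := hy
  exact ⟨b, hb, by rwa [dist_eq_norm] at hxy⟩

theorem eq_zero_of_fockRep_eq_zero {x : UniversalAlgebra} (hx : ∀ z, fockRep z x = 0) : x = 0 := by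
  refine norm_le_zero_iff.1 (le_of_forall_pos_le_add fun ε hε => ?_)
  obtain ⟨b, hb, hxb⟩ := dense_adjoin_gen x (half_pos hε)
  -- As `x` has zero images, those of `b` are, up to sign, the images of the small element `x - b`.
  have h : ‖b‖ ≤ ε / 2 := norm_le_of_mem_adjoin_gen hb (half_pos hε) fun z => by
    have h1 := NonUnitalStarAlgHom.norm_apply_le (fockRep z) (x - b)
    rw [map_sub, hx, zero_sub, norm_neg] at h1
    exact h1.trans hxb.le
  have := norm_le_norm_add_norm_sub b x
  rw [norm_sub_rev] at this
  linarith [norm_sub_rev x b]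

theorem directSumRep_injective_of_forall {ι : Type*} {H : ι → Type*}
    [∀ i, NormedAddCommGroup (H i)] [∀ i, InnerProductSpace ℂ (H i)] [∀ i, CompleteSpace (H i)]
    {A : Type*} [NonUnitalCStarAlgebra A] (π : ∀ i, A →⋆ₙₐ[ℂ] (H i →L[ℂ] H i))
    (h : ∀ a, (∀ i, π i a = 0) → a = 0) : Function.Injective (directSumRep π) := by
  classical
  refine (injective_iff_map_eq_zero _).2 fun a ha => h a fun i => ?_
  ext1 v
  -- A vector supported in one summand isolates that representation.
  have h1 := directSumRep_apply π a (lp.single 2 i v) i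
  rw [ha, lp.single_apply_self] at h1
  exact h1.symm

end Faithful

end WeaklyMonotone

theorem mainTheorem7 :
    Function.Injective
      (WeaklyMonotone.directSumRep fun z : Circle => WeaklyMonotone.fockRep z) :=
  WeaklyMonotone.directSumRep_injective_of_forall _
    fun _ => WeaklyMonotone.eq_zero_of_fockRep_eq_zero
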